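/- **Definitions.** A *pair of combinatorial multicones* of rank $q$ is a finite cyclically ordered set $M$ partitioned into two sets $M_s$, $M_u$ with $q$ elements each, which are met alternately according to the cyclic order; $x^+$ denotes the element next to $x$. A *correspondence* is a subset of $M\times M$; correspondences form a monoid under $C\circ C'=\{(x,z):\exists y,\ (x,y)\in C,\ (y,z)\in C'\}$. A correspondence $C$ is *monotonic* if $C\subset (M_s\times M_s)\sqcup(M_u\times M_u)$, $C\cap(M_s\times M_s)=\{(C_s(y),y): y\in M_s\}$ and $C\cap(M_u\times M_u)=\{(x,C_u(x)): x\in M_u\}$ for some maps $C_s:M_s\to M_s$, $C_u:M_u\to M_u$, and $C$ can be cyclically ordered so that the element next to $(x,y)$ is always $(x^{++},y)$, $(x^+,y^+)$ or $(x,y^{++})$. Let $\mathcal C(M)$ be the monoid of monotonic correspondences and $\mathcal F_N$ the free monoid on $N$ generators $a_1,\dots,a_N$. A morphism $\Phi:\mathcal F_N\to\mathcal C(M)$, with $C^{(i)}=\Phi(a_i)$, is *tight* if $\bigcup_i \operatorname{Im} C^{(i)}_u=M_u$ and $\bigcup_i \operatorname{Im} C^{(i)}_s=M_s$; it is *hyperbolic*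 if there is $\ell\ge1$ such that the image of every word of length $\ge\ell$ is a constant correspondence $M_u\times\{a_u\}\sqcup\{a_s\}\times M_s$ with $a_u\in M_u$, $a_s\in M_s$. An $N$-tuple $(A_1,\dots,A_N)\in SL(2,\mathbb R)^N$ is *uniformly hyperbolic* if the cocycle $x\mapsto A_{x_0}$ over the full shift $\sigma$ on $\{1,\dots,N\}^{\mathbb Z}$ has continuous invariant stable and unstable directions $e^s,e^u:\{1,\dots,N\}^{\mathbb Z}\to\mathbb P^1$, i.e. $A_{x_0}e^{s}(x)=e^{s}(\sigma x)$, $A_{x_0}e^{u}(x)=e^{u}(\sigma x)$, and for some $c>0$, $\lambda>1$ and all $x$ and $n\ge0$, $\|A_{x_{n-1}}\cdots A_{x_0}v\|\le c\lambda^{-n}\|v\|$ for $v\in e^s(x)$ and $\|A_{x_{-n}}^{-1}\cdots A_{x_{-1}}^{-1}v\|\le c\lambda^{-n}\|v\|$ for $v\in e^u(x)$. Let $K^u,K^s$ be the images of $e^u,e^s$. The *unstable core* $U$ is the complement of the union of the connected components of $\mathbb P^1\setminus K^u$ that intersect $K^s$; the *stable core* $S$ is defined by exchanging the roles of $K^u$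 and $K^s$. A morphism $\Phi:\mathcal F_N\to\mathcal C(M)$ is *induced* by $(A_1,\dots,A_N)$ if $M_u$ and $M_s$ can be identified with the sets of connected components of $U$ and of $S$ respectively, so that the cyclic order of $M$ is the one induced by an orientation of $\mathbb P^1$ and, for every $i$, $C^{(i)}$ is the set of pairs $(x,y)\in(M_u\times M_u)\sqcup(M_s\times M_s)$ with $A_i(x)\cap y\neq\emptyset$. **Proposition.** There exist an integer $N\ge2$, a pair of combinatorial multicones $M$ of rank $15$, and a tight hyperbolic morphism $\Phi:\mathcal F_N\to\mathcal C(M)$ which is not induced by any uniformly hyperbolic $N$-tuple of matrices in $SL(2,\mathbb R)$. -/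

import Mathlib

namespace MulticoneDynamics

/-! ### Finite cyclic orders and pairs of combinatorial multicones -/

/-- `y` is the element next to `x` in a cyclic order, usually denoted `y = x⁺`.  In a finite
cyclically ordered set with at least two elements, every `x` has exactly one next element. -/
def IsNext {α : Type*} [CircularOrder α] (x y : α) : Prop :=
  x ≠ y ∧ ∀ z, ¬ sbtw x z y

/-- A pair of combinatorial multicones: a finite cyclically ordered set `M`, partitioned into two
sets of the same cardinality which are met alternately according to the cyclic order. -/
structure MulticonePair (M : Type*) [Finite M] [CircularOrder M] where
  /-- the stable combinatorial multicone `M_s` -/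
  stable : Set M
  /-- the unstable combinatorial multicone `M_u` -/
  unstable : Set M
  isCompl : IsCompl stable unstable
  ncard_eq : stable.ncard = unstable.ncard
  alternate : ∀ x y, IsNext x y → (x ∈ stable ↔ y ∈ unstable)

/-- The rank of a pair of combinatorial multicones. -/
noncomputable def MulticonePair.rank {M : Type*} [Finite M] [CircularOrder M]
    (P : MulticonePair M) : ℕ :=
  P.unstable.ncard

/-! ### The monoid of correspondences -/

/-- A correspondence on `M` is a subset of `M × M`. -/
def Correspondence (M : Type*) : Type _ := Set (M × M)

namespace Correspondence

instance {M : Type*} : Membership (M × M) (Correspondence M) :=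
  inferInstanceAs (Membership (M × M) (Set (M × M)))

/-- The correspondences form a monoid under composition,
`C * C' = {(x, z) | ∃ y, (x, y) ∈ C ∧ (y, z) ∈ C'}`, with the diagonal as identity. -/
instance {M : Type*} : Monoid (Correspondence M) where
  mul C C' := {p : M × M | ∃ y, (p.1, y) ∈ C ∧ (y, p.2) ∈ C'}
  one := {p : M × M | p.1 = p.2}
  mul_assoc A B C := by
    refine Set.ext fun p => ⟨?_, ?_⟩
    · rintro ⟨y, ⟨z, h1, h2⟩, h3⟩
      exact ⟨z, h1, y, h2, h3⟩
    · rintro ⟨z, h1, y, h2, h3⟩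
      exact ⟨y, ⟨z, h1, h2⟩, h3⟩
  one_mul A := by
    refine Set.ext fun p => ⟨?_, fun h => ⟨p.1, rfl, h⟩⟩
    rintro ⟨y, h1, h2⟩
    obtain rfl : p.1 = y := h1
    exact h2
  mul_one A := by
    refine Set.ext fun p => ⟨?_, fun h => ⟨p.2, h, rfl⟩⟩
    rintro ⟨y, h1, h2⟩
    obtain rfl : y = p.2 := h2
    exact h1

theorem mem_mul {M : Type*} {C C' : Correspondence M} {p : M × M} :
    p ∈ C * C' ↔ ∃ y, (p.1, y) ∈ C ∧ (y, p.2) ∈ C' := Iff.rfl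

theorem mem_one {M : Type*} {p : M × M} :
    p ∈ (1 : Correspondence M) ↔ p.1 = p.2 := Iff.rfl

end Correspondence

/-- The pair `p'` is `(x⁺⁺, y)` or `(x⁺, y⁺)` or `(x, y⁺⁺)`, where `p = (x, y)`. -/
def IsStep {M : Type*} [CircularOrder M] (p p' : M × M) : Prop :=
  ((∃ t, IsNext p.1 t ∧ IsNext t p'.1) ∧ p'.2 = p.2) ∨
  (IsNext p.1 p'.1 ∧ IsNext p.2 p'.2) ∨
  (p'.1 = p.1 ∧ ∃ t, IsNext p.2 t ∧ IsNext t p'.2)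

section Pair

variable {M : Type*} [Finite M] [CircularOrder M] (P : MulticonePair M)

/-- Monotonic correspondences: the stable part of `C` is the graph `{(C_s y, y)}` of a map
`C_s : M_s → M_s`, the unstable part is the graph `{(x, C_u x)}` of a map `C_u : M_u → M_u`, and
`C` can be cyclically ordered so that the element next to `(x, y)` is always
`(x⁺⁺, y)`, `(x⁺, y⁺)` or `(x, y⁺⁺)`. -/
structure MulticonePair.IsMonotonic (C : Correspondence M) : Prop where
  same_type : ∀ p ∈ C,
    (p.1 ∈ P.stable ∧ p.2 ∈ P.stable) ∨ (p.1 ∈ P.unstable ∧ p.2 ∈ P.unstable)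
  stable_map : ∀ y ∈ P.stable, ∃! x, x ∈ P.stable ∧ (x, y) ∈ C
  unstable_map : ∀ x ∈ P.unstable, ∃! y, y ∈ P.unstable ∧ (x, y) ∈ C
  cyclic : ∃ _ : CircularOrder {p : M × M // p ∈ C},
    ∀ p p' : {p : M × M // p ∈ C}, IsNext p p' → IsStep p.1 p'.1

/-- The set `𝒞(M)` of monotonic correspondences, inside the monoid of all correspondences. -/
def MulticonePair.monotonic : Set (Correspondence M) := {C | P.IsMonotonic C}

/-- The constant correspondence `M_u × {a_u} ⊔ {a_s} × M_s`. -/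
def MulticonePair.const (as au : M) : Correspondence M :=
  {p : M × M | (p.1 ∈ P.unstable ∧ p.2 = au) ∨ (p.1 = as ∧ p.2 ∈ P.stable)}

/-- The image of the map `C_u`. -/
def MulticonePair.imageU (C : Correspondence M) : Set M :=
  {y | y ∈ P.unstable ∧ ∃ x ∈ P.unstable, (x, y) ∈ C}

/-- The image of the map `C_s`. -/
def MulticonePair.imageS (C : Correspondence M) : Set M :=
  {x | x ∈ P.stable ∧ ∃ y ∈ P.stable, (x, y) ∈ C}

variable {N : ℕ} (Φ : FreeMonoid (Fin N) →* Correspondence M)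

/-- `Φ` is hyperbolic: there is `ℓ ≥ 1` such that the image of every word of length `≥ ℓ` is a
constant correspondence. -/
def MulticonePair.IsHyperbolic : Prop :=
  ∃ ℓ : ℕ, 1 ≤ ℓ ∧ ∀ w : FreeMonoid (Fin N), ℓ ≤ w.length →
    ∃ as ∈ P.stable, ∃ au ∈ P.unstable, Φ w = P.const as au

/-- `Φ` is tight: the images of the maps `C_u^{(i)}` cover `M_u`, and the images of the maps
`C_s^{(i)}` cover `M_s`, where `C^{(i)}` is the image of the `i`-th generator. -/
def MulticonePair.IsTight : Prop :=
  (⋃ i, P.imageU (Φ (FreeMonoid.of i))) = P.unstable ∧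
  (⋃ i, P.imageS (Φ (FreeMonoid.of i))) = P.stable

end Pair

/-! ### The projective line -/

/-- The real projective line, the set of lines through the origin in `ℝ²`.  The group `SL(2, ℝ)`
acts on it through its linear action on `ℝ²`. -/
abbrev P1 : Type := Projectivization ℝ (Fin 2 → ℝ)

/-- The usual (quotient) topology of the projective line. -/
noncomputable instance : TopologicalSpace P1 :=
  TopologicalSpace.coinduced
    (fun v : {v : Fin 2 → ℝ // v ≠ 0} => Projectivization.mk ℝ v.1 v.2) inferInstance

/-- The determinant of two vectors of the plane. -/
def det2 (u v : Fin 2 → ℝ) : ℝ := u 0 * v 1 - u 1 * v 0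

/-- The standard (counterclockwise) cyclic order of the projective line: starting from `p` and
turning counterclockwise, one meets `q` before `r`, and the three points are distinct.  Each point
occurs in two of the three determinants, so the sign does not depend on the representatives. -/
def P1.Sbtw (p q r : P1) : Prop :=
  0 < det2 p.rep q.rep * det2 q.rep r.rep * det2 p.rep r.rep

/-- The set of connected components of `X`. -/
def components (X : Set P1) : Set (Set P1) := connectedComponentIn X '' X

/-- The complement of the union of those connected components of `P1 ∖ K` which intersect `L`. -/
def core (K L : Set P1) : Set P1 := (⋃₀ {c ∈ components Kᶜ | (c ∩ L).Nonempty})ᶜ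

/-! ### Uniformly hyperbolic tuples of matrices -/

section Matrices

variable {N : ℕ} (A : Fin N → Matrix.SpecialLinearGroup (Fin 2) ℝ)

/-- The left shift on the full shift `N^ℤ`. -/
def shift (x : ℤ → Fin N) : ℤ → Fin N := fun k => x (k + 1)

/-- The product `Aⁿ(x) = A_{x_{n-1}} ⋯ A_{x_0}`. -/
def cocycle (x : ℤ → Fin N) : ℕ → Matrix.SpecialLinearGroup (Fin 2) ℝ
  | 0 => 1
  | n + 1 => A (x n) * cocycle x n

/-- The product `A⁻ⁿ(x) = A_{x_{-n}}⁻¹ ⋯ A_{x_{-1}}⁻¹`. -/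
def cocycleInv (x : ℤ → Fin N) : ℕ → Matrix.SpecialLinearGroup (Fin 2) ℝ
  | 0 => 1
  | n + 1 => (A (x (-(n + 1 : ℤ))))⁻¹ * cocycleInv x n

/-- `es`, `eu` are the stable and unstable directions of the cocycle over the full shift `N^ℤ`
given by `x ↦ A_{x_0}`: they are continuous and invariant, the lines `es x` are uniformly
exponentially contracted in the future and the lines `eu x` in the past.  (All norms on `ℝ²` being
equivalent, the choice of the norm is irrelevant.) -/
structure IsHyperbolicSplitting (es eu : (ℤ → Fin N) → P1) : Prop where
  continuous_s : Continuous es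
  continuous_u : Continuous eu
  invariant_s : ∀ x, A (x 0) • es x = es (shift x)
  invariant_u : ∀ x, A (x 0) • eu x = eu (shift x)
  contraction : ∃ c l : ℝ, 0 < c ∧ 1 < l ∧ ∀ (x : ℤ → Fin N) (n : ℕ),
    (∀ v ∈ (es x).submodule, ‖cocycle A x n • v‖ ≤ c * (l ^ n)⁻¹ * ‖v‖) ∧
    (∀ v ∈ (eu x).submodule, ‖cocycleInv A x n • v‖ ≤ c * (l ^ n)⁻¹ * ‖v‖)

/-- The `N`-tuple `A` is uniformly hyperbolic with respect to the full shift. -/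
def IsUniformlyHyperbolic : Prop := ∃ es eu, IsHyperbolicSplitting A es eu

/-- The unstable core of a tuple with stable and unstable directions `es`, `eu`. -/
def unstableCore (es eu : (ℤ → Fin N) → P1) : Set P1 := core (Set.range eu) (Set.range es)

/-- The stable core of a tuple with stable and unstable directions `es`, `eu`. -/
def stableCore (es eu : (ℤ → Fin N) → P1) : Set P1 := core (Set.range es) (Set.range eu)

variable {M : Type*} [Finite M] [CircularOrder M]

/-- `Φ` is the morphism induced by the uniformly hyperbolic tuple `A`, up to an identification
`e` of `M` with the cyclically ordered set of the connected components of the two cores: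
`M_u` is identified with the set of components of the unstable core and `M_s` with the set of
components of the stable core, the cyclic order of `M` is the one induced by an orientation of the
projective line, and the image of the `i`-th generator consists of the pairs `(x, y)` of components
of the same core such that `A_i(x)` intersects `y`. -/
def MulticonePair.IsInducedBy (P : MulticonePair M) (Φ : FreeMonoid (Fin N) →* Correspondence M)
    (A : Fin N → Matrix.SpecialLinearGroup (Fin 2) ℝ) : Prop :=
  ∃ es eu, IsHyperbolicSplitting A es eu ∧ ∃ e : M → Set P1,
    Set.BijOn e P.unstable (components (unstableCore es eu)) ∧
    Set.BijOn e P.stable (components (stableCore es eu)) ∧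
    ((∀ x y z, sbtw x y z → ∀ p ∈ e x, ∀ q ∈ e y, ∀ r ∈ e z, P1.Sbtw p q r) ∨
     (∀ x y z, sbtw x y z → ∀ p ∈ e x, ∀ q ∈ e y, ∀ r ∈ e z, P1.Sbtw r q p)) ∧
    ∀ i x y, (x, y) ∈ Φ (FreeMonoid.of i) ↔
      ((x ∈ P.unstable ∧ y ∈ P.unstable) ∨ (x ∈ P.stable ∧ y ∈ P.stable)) ∧
      (((fun p => A i • p) '' e x) ∩ e y).Nonempty

end Matrices

end MulticoneDynamics

/-!
Suppose that a morphism is induced by matrices. Choosing, for each pair of a correspondence, a point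
of the first component which is mapped into the second one, and using only the cyclic order, one
gets points of the projective line and images of them in prescribed cyclic position. Let
`p₁, …, p₈` be in cyclic order. The quadrilaterals `p₁ p₂ p₅ p₆` and `p₃ p₄ p₇ p₈` are linked, which
makes the product of their cross-ratios less than one. If `A` acts on the first quadrilateral and
`B` on the second one, and if the images are linked in the opposite way, then the product for the
images is greater than one, although cross-ratios are invariant.

This happens for two generators whose stable and unstable maps take only two values each, with arcs
and values arranged so that all products of two generators are constant. Adding all the generators
with constant value makes the morphism tight. A correspondence with two-valued maps is cyclically
ordered along a lattice path with four straight pieces, a staircase in the torus `M × M`.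
-/

namespace MulticoneDynamics

/-! ### Cross-ratios of linked quadrilaterals -/

theorem det2_smul_smul (a b : ℝ) (u v : Fin 2 → ℝ) : det2 (a • u) (b • v) = a * b * det2 u v := by
  simp only [det2, Pi.smul_apply, smul_eq_mul]
  ring

theorem det2_specialLinearGroup_smul (A : Matrix.SpecialLinearGroup (Fin 2) ℝ) (u v : Fin 2 → ℝ) :
    det2 (A • u) (A • v) = det2 u v := by
  have hdet := A.det_coe
  rw [Matrix.det_fin_two] at hdet
  simp only [det2, Matrix.SpecialLinearGroup.smul_def, Matrix.smul_eq_mulVec, Matrix.mulVec,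
    dotProduct, Fin.sum_univ_two]
  linear_combination (u 0 * v 1 - u 1 * v 0) * hdet

namespace P1

/-- The determinant of the chosen representatives of two points of the projective line. Only
expressions of degree zero modulo squares in each point, such as the sign in `OrientedSbtw` or the
value of `crossRatio`, are independent of the representatives. -/
noncomputable def bracket (p q : P1) : ℝ := det2 p.rep q.rep

theorem bracket_swap (p q : P1) : bracket q p = -bracket p q := by
  simp only [bracket, det2]
  ring

theorem exists_rep_smul (A : Matrix.SpecialLinearGroup (Fin 2) ℝ) (p : P1) :
    ∃ a : ℝ, a ≠ 0 ∧ (A • p).rep = a • A • p.rep := by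
  have hne : A • p.rep ≠ 0 := (smul_ne_zero_iff_ne A).2 p.rep_nonzero
  obtain ⟨a, ha⟩ := Projectivization.exists_smul_eq_mk_rep ℝ (A • p.rep) hne
  rw [← Projectivization.smul_mk A p.rep_nonzero, p.mk_rep] at ha
  exact ⟨a, a.ne_zero, ha.symm⟩

theorem exists_bracket_smul (A : Matrix.SpecialLinearGroup (Fin 2) ℝ) :
    ∃ a : P1 → ℝ, (∀ p, a p ≠ 0) ∧
      ∀ p q, bracket (A • p) (A • q) = a p * a q * bracket p q := by
  choose a ha hrep using exists_rep_smul A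
  refine ⟨a, ha, fun p q => ?_⟩
  simp only [bracket, hrep, det2_smul_smul, det2_specialLinearGroup_smul]

/-- The three points are distinct and met in this cyclic order, for the counterclockwise orientation
of the projective line if `0 < ε` and for the clockwise one if `ε < 0`. -/
def OrientedSbtw (ε : ℝ) (p q r : P1) : Prop :=
  0 < ε * (bracket p q * bracket q r * bracket p r)

theorem Sbtw.orientedSbtw_one {p q r : P1} (h : P1.Sbtw p q r) : OrientedSbtw 1 p q r := by
  have hpos : 0 < bracket p q * bracket q r * bracket p r := h
  simpa only [OrientedSbtw, one_mul] using hpos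

theorem Sbtw.orientedSbtw_neg_one {p q r : P1} (h : P1.Sbtw r q p) :
    OrientedSbtw (-1) p q r := by
  have hpos : 0 < bracket r q * bracket q p * bracket r p := h
  rw [bracket_swap q r, bracket_swap p q, bracket_swap p r] at hpos
  unfold OrientedSbtw
  linarith

namespace OrientedSbtw

variable {ε : ℝ} {p q r : P1}

theorem rotate (h : OrientedSbtw ε p q r) : OrientedSbtw ε q r p := by
  unfold OrientedSbtw at *
  rw [bracket_swap p r, bracket_swap p q]
  linarith

theorem bracket_left_ne_zero (h : OrientedSbtw ε p q r) : bracket p q ≠ 0 := by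
  intro h0
  simp [OrientedSbtw, h0] at h

theorem bracket_right_ne_zero (h : OrientedSbtw ε p q r) : bracket p r ≠ 0 := by
  intro h0
  simp [OrientedSbtw, h0] at h

theorem smul (h : OrientedSbtw ε p q r) (A : Matrix.SpecialLinearGroup (Fin 2) ℝ) :
    OrientedSbtw ε (A • p) (A • q) (A • r) := by
  obtain ⟨a, ha, hbracket⟩ := exists_bracket_smul A
  unfold OrientedSbtw at *
  have hsq : 0 < (a p * a q * a r) ^ 2 :=
    sq_pos_of_ne_zero (mul_ne_zero (mul_ne_zero (ha p) (ha q)) (ha r))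
  calc 0 < (a p * a q * a r) ^ 2 * (ε * (bracket p q * bracket q r * bracket p r)) :=
        mul_pos hsq h
    _ = ε * (bracket (A • p) (A • q) * bracket (A • q) (A • r) * bracket (A • p) (A • r)) := by
        simp only [hbracket]
        ring

end OrientedSbtw

/-- An affine coordinate of the projective line, with `b` at infinity. -/
theorem exists_affineCoordinate {ε : ℝ} (hε : ε ≠ 0) (b : P1) :
    ∃ x : P1 → ℝ, ∀ p q, bracket b p ≠ 0 → bracket b q ≠ 0 →
      bracket p q = ε * (bracket b p * bracket b q * (x q - x p)) := by
  have hnorm : b.rep 0 ^ 2 + b.rep 1 ^ 2 ≠ 0 := by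
    intro h
    have h0 : b.rep 0 = 0 := by nlinarith [sq_nonneg (b.rep 0), sq_nonneg (b.rep 1)]
    have h1 : b.rep 1 = 0 := by nlinarith [sq_nonneg (b.rep 0), sq_nonneg (b.rep 1)]
    exact b.rep_nonzero (funext fun i => by fin_cases i <;> assumption)
  refine ⟨fun p => -(b.rep 0 * p.rep 0 + b.rep 1 * p.rep 1) /
    (ε * (bracket b p * (b.rep 0 ^ 2 + b.rep 1 ^ 2))), fun p q hp hq => ?_⟩
  field_simp
  simp only [bracket, det2]
  ring

theorem OrientedSbtw.lt_of_affineCoordinate {ε : ℝ} {b p q : P1} {x : P1 → ℝ}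
    (hx : ∀ p q, bracket b p ≠ 0 → bracket b q ≠ 0 →
      bracket p q = ε * (bracket b p * bracket b q * (x q - x p)))
    (h : OrientedSbtw ε b p q) : x p < x q := by
  have hpos : 0 < (ε * bracket b p * bracket b q) ^ 2 * (x q - x p) := by
    have hpq := hx p q h.bracket_left_ne_zero h.bracket_right_ne_zero
    unfold OrientedSbtw at h
    rw [hpq] at h
    linarith
  exact sub_pos.1 (pos_of_mul_pos_right hpos (sq_nonneg _))

theorem OrientedSbtw.of_chain {ε : ℝ} (hε : ε ≠ 0) {p q r t : P1} (h : OrientedSbtw ε p q r)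
    (h' : OrientedSbtw ε p r t) : OrientedSbtw ε q r t := by
  obtain ⟨x, hx⟩ := exists_affineCoordinate hε p
  have hq := h.bracket_left_ne_zero
  have hr := h.bracket_right_ne_zero
  have ht := h'.bracket_right_ne_zero
  have hqr : 0 < x r - x q := sub_pos.2 (h.lt_of_affineCoordinate hx)
  have hrt : 0 < x t - x r := sub_pos.2 (h'.lt_of_affineCoordinate hx)
  have hqt : 0 < x t - x q := by linarith
  unfold OrientedSbtw
  rw [hx q r hq hr, hx r t hr ht, hx q t hq ht]
  calc 0 < (ε ^ 2 * (bracket p q * bracket p r * bracket p t)) ^ 2 *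
        ((x r - x q) * (x t - x r) * (x t - x q)) := by positivity
    _ = _ := by ring

/-- The cross-ratio of four points, the products of the lengths of the opposite sides of a
quadrilateral being compared; for distinct points in cyclic order it is positive. -/
noncomputable def crossRatio (p q r t : P1) : ℝ :=
  bracket p q * bracket r t / (bracket q r * bracket p t)

theorem crossRatio_smul (A : Matrix.SpecialLinearGroup (Fin 2) ℝ) (p q r t : P1) :
    crossRatio (A • p) (A • q) (A • r) (A • t) = crossRatio p q r t := by
  obtain ⟨a, ha, hbracket⟩ := exists_bracket_smul A
  have hne : a p * a q * a r * a t ≠ 0 :=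
    mul_ne_zero (mul_ne_zero (mul_ne_zero (ha p) (ha q)) (ha r)) (ha t)
  simp only [crossRatio, hbracket]
  rw [← mul_div_mul_left (bracket p q * bracket r t) _ hne]
  congr 1 <;> ring

theorem crossRatio_rotate (p q r t : P1) : crossRatio t p q r = (crossRatio p q r t)⁻¹ := by
  rw [crossRatio, crossRatio, inv_div, bracket_swap p t, bracket_swap r t]
  ring

/-- For eight points in cyclic order, the quadrilaterals `p₁ p₂ p₅ p₆` and `p₃ p₄ p₇ p₈` are
linked. -/
theorem crossRatio_mul_crossRatio_mem_Ioo {ε : ℝ} (hε : ε ≠ 0) {p₁ p₂ p₃ p₄ p₅ p₆ p₇ p₈ : P1}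
    (h₂₃ : OrientedSbtw ε p₁ p₂ p₃) (h₃₄ : OrientedSbtw ε p₁ p₃ p₄)
    (h₄₅ : OrientedSbtw ε p₁ p₄ p₅) (h₅₆ : OrientedSbtw ε p₁ p₅ p₆)
    (h₆₇ : OrientedSbtw ε p₁ p₆ p₇) (h₇₈ : OrientedSbtw ε p₁ p₇ p₈) :
    crossRatio p₁ p₂ p₅ p₆ * crossRatio p₃ p₄ p₇ p₈ ∈ Set.Ioo 0 1 := by
  obtain ⟨x, hx⟩ := exists_affineCoordinate hε p₁
  have n₂ := h₂₃.bracket_left_ne_zero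
  have n₃ := h₂₃.bracket_right_ne_zero
  have n₄ := h₄₅.bracket_left_ne_zero
  have n₅ := h₄₅.bracket_right_ne_zero
  have n₆ := h₆₇.bracket_left_ne_zero
  have n₇ := h₆₇.bracket_right_ne_zero
  have n₈ := h₇₈.bracket_right_ne_zero
  have x₂₃ := h₂₃.lt_of_affineCoordinate hx
  have x₃₄ := h₃₄.lt_of_affineCoordinate hx
  have x₄₅ := h₄₅.lt_of_affineCoordinate hx
  have x₅₆ := h₅₆.lt_of_affineCoordinate hx
  have x₆₇ := h₆₇.lt_of_affineCoordinate hx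
  have x₇₈ := h₇₈.lt_of_affineCoordinate hx
  have d₂₅ : 0 < x p₅ - x p₂ := by linarith
  have d₃₄ : 0 < x p₄ - x p₃ := by linarith
  have d₃₈ : 0 < x p₈ - x p₃ := by linarith
  have d₄₇ : 0 < x p₇ - x p₄ := by linarith
  have d₅₆ : 0 < x p₆ - x p₅ := by linarith
  have d₇₈ : 0 < x p₈ - x p₇ := by linarith
  have hcr : crossRatio p₁ p₂ p₅ p₆ * crossRatio p₃ p₄ p₇ p₈ =
      (x p₆ - x p₅) * ((x p₄ - x p₃) * (x p₈ - x p₇)) /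
        ((x p₇ - x p₄) * ((x p₅ - x p₂) * (x p₈ - x p₃))) := by
    rw [crossRatio, crossRatio, hx _ _ n₅ n₆, hx _ _ n₂ n₅, hx _ _ n₃ n₄, hx _ _ n₇ n₈,
      hx _ _ n₄ n₇, hx _ _ n₃ n₈]
    field_simp
  rw [hcr]
  refine ⟨by positivity, (div_lt_one (by positivity)).2 ?_⟩
  gcongr ?_ * (?_ * ?_) <;> linarith

/-- The product of the two cross-ratios is less than one before applying `A` and `B`; after that,
the images of the quadrilaterals are linked in the order which makes it greater than one. -/
theorem not_linked_smul {ε : ℝ} (hε : ε ≠ 0) (A B : Matrix.SpecialLinearGroup (Fin 2) ℝ)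
    {p : Fin 8 → P1} (hp : ∀ k l m, k < l → l < m → OrientedSbtw ε (p k) (p l) (p m))
    (h₂₃ : OrientedSbtw ε (A • p 5) (A • p 0) (B • p 7))
    (h₃₄ : OrientedSbtw ε (A • p 5) (B • p 7) (B • p 2))
    (h₄₅ : OrientedSbtw ε (A • p 5) (B • p 2) (A • p 1))
    (h₆₇ : OrientedSbtw ε (A • p 5) (A • p 4) (B • p 3))
    (h₇₈ : OrientedSbtw ε (A • p 5) (B • p 3) (B • p 6)) : False := by
  have h₅₆ : OrientedSbtw ε (A • p 5) (A • p 1) (A • p 4) :=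
    (hp 1 4 5 (by decide) (by decide)).rotate.rotate.smul A
  have himage := crossRatio_mul_crossRatio_mem_Ioo hε h₂₃ h₃₄ h₄₅ h₅₆ h₆₇ h₇₈
  have hsource : crossRatio (p 0) (p 1) (p 4) (p 5) * crossRatio (p 2) (p 3) (p 6) (p 7) ∈
      Set.Ioo 0 1 := by
    apply crossRatio_mul_crossRatio_mem_Ioo hε <;> exact hp _ _ _ (by decide) (by decide)
  rw [crossRatio_smul, crossRatio_smul, crossRatio_rotate (p 0), crossRatio_rotate (p 2), ← mul_inv]
    at himage
  exact lt_asymm himage.2 ((one_lt_inv₀ hsource.1).2 hsource.2)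

end P1

section Obstruction

variable {M : Type*} [Finite M] [CircularOrder M] {P : MulticonePair M} {N : ℕ}
  {Φ : FreeMonoid (Fin N) →* Correspondence M} {A : Fin N → Matrix.SpecialLinearGroup (Fin 2) ℝ}

theorem MulticonePair.IsInducedBy.exists_points (h : P.IsInducedBy Φ A) :
    ∃ e : M → Set P1,
      (∃ ε : ℝ, ε ≠ 0 ∧ ∀ x y z, sbtw x y z →
        ∀ p ∈ e x, ∀ q ∈ e y, ∀ r ∈ e z, P1.OrientedSbtw ε p q r) ∧
      ∀ i x y, (x, y) ∈ Φ (FreeMonoid.of i) → ∃ p ∈ e x, A i • p ∈ e y := by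
  obtain ⟨es, eu, -, e, -, -, hord, hmem⟩ := h
  refine ⟨e, ?_, fun i x y hxy => ?_⟩
  · rcases hord with h | h
    · exact ⟨1, by norm_num, fun x y z hs p hp q hq r hr =>
        (h x y z hs p hp q hq r hr).orientedSbtw_one⟩
    · exact ⟨-1, by norm_num, fun x y z hs p hp q hq r hr =>
        (h x y z hs p hp q hq r hr).orientedSbtw_neg_one⟩
  · obtain ⟨_, ⟨p, hp, rfl⟩, hq⟩ := ((hmem i x y).1 hxy).2
    exact ⟨p, hp, hq⟩

/-- The images of the points `0, …, 7` are met in the cyclic order `5, 0, 7, 2, 1, 4, 3, 6`, where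
`g 0` acts on `0, 1, 4, 5` and `g 1` on `2, 3, 6, 7`. -/
theorem MulticonePair.not_isInducedBy (g : Fin 2 → Fin N)
    (d : Fin 8 → M) (hd : ∀ k l m, k < l → l < m → sbtw (d k) (d l) (d m))
    (t : Fin 4 → M) (ht : ∀ k l m, k < l → l < m → sbtw (t k) (t l) (t m))
    (hΦ : ∀ k, (d k, t (![0, 2, 1, 3, 2, 0, 3, 1] k)) ∈
      Φ (FreeMonoid.of (g (![0, 0, 1, 1, 0, 0, 1, 1] k)))) : ¬ P.IsInducedBy Φ A := by
  intro hind
  obtain ⟨e, ⟨ε, hε, horient⟩, hpoint⟩ := hind.exists_points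
  choose p hp hpA using fun k => hpoint _ _ _ (hΦ k)
  have source : ∀ k l m, k < l → l < m → P1.OrientedSbtw ε (p k) (p l) (p m) :=
    fun k l m hkl hlm => horient _ _ _ (hd k l m hkl hlm) _ (hp k) _ (hp l) _ (hp m)
  have target : ∀ k l m, k < l → l < m → ∀ {a}, a ∈ e (t k) → ∀ {b}, b ∈ e (t l) →
      ∀ {c}, c ∈ e (t m) → P1.OrientedSbtw ε a b c :=
    fun k l m hkl hlm _ ha _ hb _ hc => horient _ _ _ (ht k l m hkl hlm) _ ha _ hb _ hc
  have h₂₃ : P1.OrientedSbtw ε (A (g 0) • p 5) (A (g 0) • p 0) (A (g 1) • p 7) :=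
    ((source 0 1 5 (by decide) (by decide)).rotate.smul (A (g 0))).of_chain hε
      (target 0 1 2 (by decide) (by decide) (hpA 0) (hpA 7) (hpA 1)).rotate.rotate
  have h₃₄ : P1.OrientedSbtw ε (A (g 0) • p 5) (A (g 1) • p 7) (A (g 1) • p 2) :=
    (target 0 1 3 (by decide) (by decide) (hpA 5) (hpA 7) (hpA 3)).rotate.rotate.of_chain hε
      ((source 2 3 7 (by decide) (by decide)).rotate.smul (A (g 1)))
  have h₄₅ : P1.OrientedSbtw ε (A (g 0) • p 5) (A (g 1) • p 2) (A (g 0) • p 1) :=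
    target 0 1 2 (by decide) (by decide) (hpA 5) (hpA 2) (hpA 1)
  have h₆₇ : P1.OrientedSbtw ε (A (g 0) • p 5) (A (g 0) • p 4) (A (g 1) • p 3) :=
    target 0 2 3 (by decide) (by decide) (hpA 5) (hpA 4) (hpA 3)
  have h₇₈ : P1.OrientedSbtw ε (A (g 0) • p 5) (A (g 1) • p 3) (A (g 1) • p 6) :=
    (((source 3 6 7 (by decide) (by decide)).rotate.rotate.smul (A (g 1))).of_chain hε
      (target 0 1 3 (by decide) (by decide) (hpA 5) (hpA 7) (hpA 6)).rotate).rotate.rotate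
  exact P1.not_linked_smul hε (A (g 0)) (A (g 1)) source h₂₃ h₃₄ h₄₅ h₆₇ h₇₈

end Obstruction

/-! ### Correspondences given by graphs of maps -/

theorem Correspondence.ext {M : Type*} {C C' : Correspondence M}
    (h : ∀ x y, (x, y) ∈ C ↔ (x, y) ∈ C') : C = C' :=
  Set.ext fun ⟨x, y⟩ => h x y

section CyclicOrder

theorem val_add_one_eq_ite {n : ℕ} [NeZero n] (x : Fin n) :
    (x + 1).val = if x.val + 1 < n then x.val + 1 else 0 := by
  have hx := x.isLt
  split_ifs with h
  · exact Fin.val_add_one_of_lt' h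
  · rw [Fin.val_add, Fin.val_one', Nat.add_mod_mod, show x.val + 1 = n by omega, Nat.mod_self]

theorem isNext_iff_eq_add_one {n : ℕ} [NeZero n] (hn : 1 < n) {x y : Fin n} :
    IsNext x y ↔ y = x + 1 := by
  simp only [IsNext, Fin.sbtw_iff, Fin.lt_def, ne_eq, Fin.ext_iff, val_add_one_eq_ite]
  refine ⟨fun ⟨_, hbtw⟩ => ?_, fun h => ⟨?_, fun z => ?_⟩⟩
  · have hz := hbtw (x + 1)
    rw [val_add_one_eq_ite] at hz
    grind
  · grind
  · grind

variable {M : Type*} [CircularOrder M]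

theorem exists_circularOrder_isStep {C : Correspondence M} {n : ℕ} [NeZero n] (hn : 1 < n)
    (f : Fin n → M × M) (hinj : Function.Injective f) (hrange : ∀ p, p ∈ C ↔ p ∈ Set.range f)
    (hstep : ∀ i, IsStep (f i) (f (i + 1))) :
    ∃ _ : CircularOrder {p : M × M // p ∈ C},
      ∀ p p' : {p : M × M // p ∈ C}, IsNext p p' → IsStep p.1 p'.1 := by
  have hbij : Function.Bijective fun i => (⟨f i, (hrange _).2 ⟨i, rfl⟩⟩ : {p // p ∈ C}) := by
    refine ⟨fun i j hij => hinj (congrArg Subtype.val hij), fun p => ?_⟩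
    obtain ⟨i, hi⟩ := (hrange p).1 p.2
    exact ⟨i, Subtype.ext hi⟩
  let E := Equiv.ofBijective _ hbij
  let _ : LinearOrder {p // p ∈ C} := LinearOrder.lift' E.symm E.symm.injective
  refine ⟨LinearOrder.toCircularOrder _, fun p p' hnext => ?_⟩
  obtain ⟨i, rfl⟩ := E.surjective p
  obtain ⟨j, rfl⟩ := E.surjective p'
  have hij : IsNext i j := by
    refine ⟨fun h => hnext.1 (congrArg E h), fun k hk => hnext.2 (E k) ?_⟩
    rw [← E.symm_apply_apply i, ← E.symm_apply_apply j, ← E.symm_apply_apply k] at hk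
    exact hk
  rw [(isNext_iff_eq_add_one hn).1 hij]
  exact hstep i

end CyclicOrder

section Contraction

variable {ι M : Type*} {T : Set M} {c : ι → M → M} {N n : ℕ}

/-- A family of self-maps of `T` *contracts in two steps* if the composition of any two of them is
constant. -/
structure ContractsInTwoSteps (T : Set M) (c : ι → M → M) : Prop where
  mapsTo : ∀ i, Set.MapsTo (c i) T T
  comp : ∀ i j, ∃ a ∈ T, ∀ x ∈ T, c i (c j x) = a

theorem ContractsInTwoSteps.append_const {c : Fin N → M → M} (hc : ContractsInTwoSteps T c)
    {a : Fin n → M} (ha : ∀ k, a k ∈ T) :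
    ContractsInTwoSteps T (Fin.append c fun k _ => a k) where
  mapsTo := by
    refine Fin.addCases (fun i => ?_) fun k x _ => ?_
    · simpa only [Fin.append_left] using hc.mapsTo i
    · simpa only [Fin.append_right] using ha k
  comp := by
    refine Fin.addCases (fun i => Fin.addCases (fun j => ?_) fun l => ?_)
      fun k j => ⟨a k, ha k, fun x _ => by rw [Fin.append_right]⟩
    · simpa only [Fin.append_left] using hc.comp i j
    · simp only [Fin.append_left, Fin.append_right]
      exact ⟨c i (a l), hc.mapsTo i (ha l), fun _ _ => rfl⟩

end Contraction

namespace MulticonePair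

variable {M : Type*} [Finite M] [CircularOrder M] {P : MulticonePair M}

theorem notMem_stable {x : M} (hx : x ∈ P.unstable) : x ∉ P.stable :=
  Set.disjoint_right.1 P.isCompl.disjoint hx

theorem mem_stable_or_mem_unstable (P : MulticonePair M) (x : M) :
    x ∈ P.stable ∨ x ∈ P.unstable :=
  P.isCompl.sup_eq_top.ge (Set.mem_univ x)

variable (P) in
/-- The correspondence with stable map `C_s = cs` and unstable map `C_u = cu`; only the values of
`cs` on the stable points and of `cu` on the unstable points matter. -/
def graph (cs cu : M → M) : Correspondence M :=
  {p | (p.1 ∈ P.unstable ∧ p.2 = cu p.1) ∨ (p.1 = cs p.2 ∧ p.2 ∈ P.stable)}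

variable {cs cs' cu cu' : M → M}

theorem mem_graph {x y : M} :
    (x, y) ∈ P.graph cs cu ↔ (x ∈ P.unstable ∧ y = cu x) ∨ (x = cs y ∧ y ∈ P.stable) :=
  Iff.rfl

theorem graph_congr (hs : Set.EqOn cs cs' P.stable) (hu : Set.EqOn cu cu' P.unstable) :
    P.graph cs cu = P.graph cs' cu' :=
  Correspondence.ext fun x y => or_congr
    (and_congr_right fun hx => by rw [hu hx]) (and_congr_left fun hy => by rw [hs hy])

theorem graph_id : P.graph id id = 1 := by
  refine Correspondence.ext fun x y => ?_
  rw [mem_graph, Correspondence.mem_one]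
  constructor
  · rintro (⟨-, h⟩ | ⟨h, -⟩)
    exacts [h.symm, h]
  · intro h
    obtain rfl : x = y := h
    exact (P.mem_stable_or_mem_unstable x).symm.imp (⟨·, rfl⟩) (⟨rfl, ·⟩)

theorem graph_mul (hs : Set.MapsTo cs' P.stable P.stable)
    (hu : Set.MapsTo cu P.unstable P.unstable) :
    P.graph cs cu * P.graph cs' cu' = P.graph (cs ∘ cs') (cu' ∘ cu) := by
  refine Correspondence.ext fun x z => ?_
  simp only [Correspondence.mem_mul, mem_graph, Function.comp_apply]
  constructor
  · rintro ⟨y, ⟨hx, rfl⟩ | ⟨rfl, hy⟩, ⟨hy', rfl⟩ | ⟨h, hz⟩⟩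
    · exact Or.inl ⟨hx, rfl⟩
    · exact absurd (h ▸ hs hz) (notMem_stable (hu hx))
    · exact absurd hy (notMem_stable hy')
    · exact Or.inr ⟨by rw [h], hz⟩
  · rintro (⟨hx, rfl⟩ | ⟨rfl, hz⟩)
    · exact ⟨cu x, Or.inl ⟨hx, rfl⟩, Or.inl ⟨hu hx, rfl⟩⟩
    · exact ⟨cs' z, Or.inr ⟨rfl, hs hz⟩, Or.inr ⟨rfl, hz⟩⟩

theorem isMonotonic_graph (hs : Set.MapsTo cs P.stable P.stable)
    (hu : Set.MapsTo cu P.unstable P.unstable) {n : ℕ} [NeZero n] (hn : 1 < n)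
    (f : Fin n → M × M) (hinj : Function.Injective f)
    (hrange : ∀ p, p ∈ P.graph cs cu ↔ p ∈ Set.range f)
    (hstep : ∀ i, IsStep (f i) (f (i + 1))) : P.IsMonotonic (P.graph cs cu) where
  same_type := by
    rintro ⟨x, y⟩ (⟨hx, rfl : y = cu x⟩ | ⟨rfl : x = cs y, hy⟩)
    exacts [Or.inr ⟨hx, hu hx⟩, Or.inl ⟨hs hy, hy⟩]
  stable_map y hy := by
    refine ⟨cs y, ⟨hs hy, Or.inr ⟨rfl, hy⟩⟩, ?_⟩
    rintro x ⟨hx, ⟨hx', -⟩ | ⟨h, -⟩⟩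
    exacts [absurd hx (notMem_stable hx'), h]
  unstable_map x hx := by
    refine ⟨cu x, ⟨hu hx, Or.inl ⟨hx, rfl⟩⟩, ?_⟩
    rintro y ⟨hy, ⟨-, h⟩ | ⟨-, hy'⟩⟩
    exacts [h, absurd hy' (notMem_stable hy)]
  cyclic := exists_circularOrder_isStep hn f hinj hrange hstep

theorem const_mul_graph {as au : M} (hs : Set.MapsTo cs P.stable P.stable) (hau : au ∈ P.unstable) :
    P.const as au * P.graph cs cu = P.const as (cu au) :=
  graph_mul (cs := fun _ => as) (cu := fun _ => au) hs fun _ _ => hau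

section Words

variable {N : ℕ} {cs cu : Fin N → M → M}

variable (P cs cu) in
/-- The morphism sending the `i`-th generator to the correspondence with maps `cs i` and `cu i`. -/
def graphMorphism : FreeMonoid (Fin N) →* Correspondence M :=
  FreeMonoid.lift fun i => P.graph (cs i) (cu i)

theorem graphMorphism_of (i : Fin N) :
    P.graphMorphism cs cu (FreeMonoid.of i) = P.graph (cs i) (cu i) :=
  FreeMonoid.lift_eval_of _ i

theorem exists_const_mul_graphMorphism (hs : ∀ i, Set.MapsTo (cs i) P.stable P.stable)
    (hu : ∀ i, Set.MapsTo (cu i) P.unstable P.unstable) (as : M) (w : FreeMonoid (Fin N)) :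
    ∀ au ∈ P.unstable, ∃ bu ∈ P.unstable,
      P.const as au * P.graphMorphism cs cu w = P.const as bu := by
  induction w using FreeMonoid.inductionOn' with
  | one => exact fun au hau => ⟨au, hau, by rw [map_one, mul_one]⟩
  | of_mul i w ih =>
    intro au hau
    rw [map_mul, graphMorphism_of, ← mul_assoc, const_mul_graph (hs i) hau]
    exact ih (cu i au) (hu i hau)

theorem exists_graphMorphism_eq_const (hs : ContractsInTwoSteps P.stable cs)
    (hu : ContractsInTwoSteps P.unstable cu) (i j : Fin N) (w : FreeMonoid (Fin N)) :
    ∃ as ∈ P.stable, ∃ au ∈ P.unstable,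
      P.graphMorphism cs cu (FreeMonoid.of i * (FreeMonoid.of j * w)) = P.const as au := by
  obtain ⟨as, has, hsa⟩ := hs.comp i j
  obtain ⟨au, hau, hua⟩ := hu.comp j i
  obtain ⟨bu, hbu, hw⟩ := exists_const_mul_graphMorphism hs.mapsTo hu.mapsTo as w au hau
  have hij : P.graph (cs i) (cu i) * P.graph (cs j) (cu j) = P.const as au := by
    rw [graph_mul (hs.mapsTo j) (hu.mapsTo i)]
    exact graph_congr hsa hua
  refine ⟨as, has, bu, hbu, ?_⟩
  rw [map_mul, map_mul, graphMorphism_of, graphMorphism_of, ← mul_assoc, hij, hw]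

theorem isHyperbolic_graphMorphism (hs : ContractsInTwoSteps P.stable cs)
    (hu : ContractsInTwoSteps P.unstable cu) : P.IsHyperbolic (P.graphMorphism cs cu) := by
  refine ⟨2, one_le_two, fun w hw => ?_⟩
  cases w using FreeMonoid.casesOn with
  | one => simp at hw
  | of_mul i w =>
    cases w using FreeMonoid.casesOn with
    | one => simp at hw
    | of_mul j w => exact exists_graphMorphism_eq_const hs hu i j w

theorem graphMorphism_mem_monotonic (hs : ContractsInTwoSteps P.stable cs)
    (hu : ContractsInTwoSteps P.unstable cu) (hone : P.IsMonotonic 1)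
    (hgen : ∀ i, P.IsMonotonic (P.graph (cs i) (cu i)))
    (hconst : ∀ as ∈ P.stable, ∀ au ∈ P.unstable, P.IsMonotonic (P.const as au))
    (w : FreeMonoid (Fin N)) : P.graphMorphism cs cu w ∈ P.monotonic := by
  cases w using FreeMonoid.casesOn with
  | one => rwa [map_one]
  | of_mul i w =>
    cases w using FreeMonoid.casesOn with
    | one =>
      rw [mul_one, graphMorphism_of]
      exact hgen i
    | of_mul j w =>
      obtain ⟨as, has, au, hau, hw⟩ := exists_graphMorphism_eq_const hs hu i j w
      rw [hw]
      exact hconst as has au hau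

theorem isTight_append_const {n : ℕ} {as au : Fin n → M} (has : Set.range as = P.stable)
    (hau : Set.range au = P.unstable) :
    P.IsTight
      (P.graphMorphism (Fin.append cs fun k _ => as k) (Fin.append cu fun k _ => au k)) := by
  constructor <;> refine Set.Subset.antisymm (Set.iUnion_subset fun i x hx => hx.1) fun x hx => ?_
  · obtain ⟨k, rfl⟩ := hau.ge hx
    refine Set.mem_iUnion.2 ⟨Fin.natAdd N k, hx, au k, hx, ?_⟩
    rw [graphMorphism_of, Fin.append_right, Fin.append_right]
    exact Or.inl ⟨hx, rfl⟩
  · obtain ⟨k, rfl⟩ := has.ge hx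
    refine Set.mem_iUnion.2 ⟨Fin.natAdd N k, hx, as k, hx, ?_⟩
    rw [graphMorphism_of, Fin.append_right, Fin.append_right]
    exact Or.inr ⟨rfl, hx⟩

end Words

end MulticonePair

/-! ### Two-valued maps and staircases -/

section ArcMap

variable {M : Type*} [CircularOrder M]

open Classical in
/-- The map with value `v'` on the open arc from `a` to `b` and `v` elsewhere; the open arc from `a`
to `a` is empty. -/
noncomputable def arcMap (a b v v' : M) (x : M) : M := if sbtw a x b then v' else v

theorem arcMap_of_not_sbtw {a b x : M} (h : ¬ sbtw a x b) (v v' : M) : arcMap a b v v' x = v :=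
  if_neg h

theorem arcMap_self (a v v' x : M) : arcMap a a v v' x = v :=
  arcMap_of_not_sbtw sbtw_irrefl_left_right v v'

theorem arcMap_mem {T : Set M} {v v' : M} (hv : v ∈ T) (hv' : v' ∈ T) (a b x : M) :
    arcMap a b v v' x ∈ T := by
  unfold arcMap
  split_ifs <;> assumption

theorem arcMap_arcMap {a b v v' c d w w' : M} (hw : ¬ sbtw a w b) (hw' : ¬ sbtw a w' b) (x : M) :
    arcMap a b v v' (arcMap c d w w' x) = v :=
  arcMap_of_not_sbtw (arcMap_mem (T := {y | ¬ sbtw a y b}) hw hw' c d x) v v'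

theorem contractsInTwoSteps_arcMap {ι : Type*} {T : Set M} {a b v v' : ι → M} (hv : ∀ i, v i ∈ T)
    (hv' : ∀ i, v' i ∈ T) (hout : ∀ i j, ¬ sbtw (a i) (v j) (b i))
    (hout' : ∀ i j, ¬ sbtw (a i) (v' j) (b i)) :
    ContractsInTwoSteps T fun i => arcMap (a i) (b i) (v i) (v' i) where
  mapsTo i x _ := arcMap_mem (hv i) (hv' i) (a i) (b i) x
  comp i j := ⟨v i, hv i, fun x _ => arcMap_arcMap (hout i j) (hout' i j) x⟩

end ArcMap

section FinCyclicOrder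

variable {n : ℕ} {x y z : Fin n}

theorem val_sub_eq_ite (x y : Fin n) :
    (x - y).val = if y ≤ x then x.val - y.val else n + x.val - y.val := by
  split_ifs with h
  · exact Fin.sub_val_of_le h
  · exact Fin.coe_sub_iff_lt.2 (not_le.1 h)

theorem sbtw_iff_sub_lt_sub : sbtw x y z ↔ y ≠ x ∧ y - x < z - x := by
  simp only [Fin.sbtw_iff, Fin.lt_def, val_sub_eq_ite, Fin.le_def, Fin.ext_iff, ne_eq]
  grind

variable [NeZero n]

theorem sbtw_iff_sub_add_one_lt_sub : sbtw x y z ↔ y ≠ z ∧ x - (z + 1) < y - (z + 1) := by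
  simp only [Fin.sbtw_iff, Fin.lt_def, val_sub_eq_ite, Fin.le_def, Fin.ext_iff, ne_eq,
    val_add_one_eq_ite]
  grind

theorem eq_add_one_of_val (h : y.val = x.val + 1) : y = x + 1 := by
  rw [Fin.ext_iff, val_add_one_eq_ite, if_pos (h ▸ y.isLt), h]

theorem eq_add_two_of_val (h : y.val = x.val + 2) : y = x + (1 + 1) := by
  rw [← add_assoc]
  refine eq_add_one_of_val ?_
  rw [val_add_one_eq_ite, if_pos (by omega), h]

theorem isStep_of_eq_add (hn : 1 < n) {p p' : Fin n × Fin n}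
    (h : p' = p + (1 + 1, 0) ∨ p' = p + (1, 1) ∨ p' = p + (0, 1 + 1)) : IsStep p p' := by
  simp only [IsStep, isNext_iff_eq_add_one hn]
  rcases h with rfl | rfl | rfl
  · exact Or.inl ⟨⟨p.1 + 1, rfl, (add_assoc _ _ _).symm⟩, add_zero _⟩
  · exact Or.inr (Or.inl ⟨rfl, rfl⟩)
  · exact Or.inr (Or.inr ⟨add_zero _, p.2 + 1, rfl, (add_assoc _ _ _).symm⟩)

end FinCyclicOrder

section Staircase

variable {n : ℕ}

/-- The ordinate of the `i`-th point of `staircase`. -/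
def stairHeight (n σ β i : ℕ) : ℕ := max (min (2 * i - σ) β) (2 * i - (n - 1))

theorem stairHeight_lt {σ β i : ℕ} (hβ : β < n) (hi : i < n) : stairHeight n σ β i < n := by
  unfold stairHeight
  omega

theorem stairHeight_le (σ β : ℕ) {i : ℕ} (hi : i < n) : stairHeight n σ β i ≤ 2 * i := by
  unfold stairHeight
  omega

theorem two_mul_sub_stairHeight_lt (σ β : ℕ) {i : ℕ} (hi : i < n) :
    2 * i - stairHeight n σ β i < n := by
  unfold stairHeight
  omega

/-- The points `(x, y)` with `x + y` even of the lattice path which climbs from `(0, 0)` to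
`(n - 1, n - 1)` at first along the line `y = 0`, then along `x = σ`, `y = β` and `x = n - 1`,
enumerated by `(x + y) / 2`. -/
def staircase (σ β i : Fin n) : Fin n × Fin n :=
  (⟨2 * i - stairHeight n σ β i, two_mul_sub_stairHeight_lt σ β i.isLt⟩,
    ⟨stairHeight n σ β i, stairHeight_lt β.isLt i.isLt⟩)

theorem staircase_injective (σ β : Fin n) : Function.Injective (staircase σ β) := by
  intro i j h
  simp only [staircase, Prod.mk.injEq, Fin.mk.injEq, stairHeight] at h
  omega

variable {σ β : Fin n}

theorem mem_range_staircase_iff (hn : Even n) (hσ : Odd σ.val) (hβ : Even β.val)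
    {p : Fin n × Fin n} :
    p ∈ Set.range (staircase σ β) ↔
      (Even p.1.val ∧ p.2.val = if σ.val < p.1.val then β.val else 0) ∨
      (p.1.val = (if p.2.val < β.val then σ.val else n - 1) ∧ Odd p.2.val) := by
  simp only [Nat.even_iff, Nat.odd_iff] at *
  constructor
  · rintro ⟨i, hp⟩
    have hx : p.1.val = 2 * i - stairHeight n σ β i := by rw [← hp, staircase]
    have hy : p.2.val = stairHeight n σ β i := by rw [← hp, staircase]
    unfold stairHeight at hx hy
    rcases Nat.mod_two_eq_zero_or_one p.2.val with hpar | hpar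
    · refine Or.inl ⟨by omega, ?_⟩
      split_ifs <;> omega
    · refine Or.inr ⟨?_, hpar⟩
      split_ifs <;> omega
  · intro h
    refine ⟨⟨(p.1 + p.2) / 2, by omega⟩, Prod.ext (Fin.ext ?_) (Fin.ext ?_)⟩ <;>
      simp only [staircase, stairHeight] <;> split_ifs at h <;> omega

theorem staircase_add_one [NeZero n] (σ β i : Fin n) :
    staircase σ β (i + 1) = staircase σ β i + (1 + 1, 0) ∨
    staircase σ β (i + 1) = staircase σ β i + (1, 1) ∨
    staircase σ β (i + 1) = staircase σ β i + (0, 1 + 1) := by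
  by_cases hi : i.val + 1 < n
  · have hval : (i + 1).val = i.val + 1 := Fin.val_add_one_of_lt' hi
    have hstep : stairHeight n σ β (i + 1).val = stairHeight n σ β i ∨
        stairHeight n σ β (i + 1).val = stairHeight n σ β i + 1 ∨
        stairHeight n σ β (i + 1).val = stairHeight n σ β i + 2 := by
      unfold stairHeight
      omega
    have hle : stairHeight n σ β i ≤ 2 * i := stairHeight_le _ _ i.isLt
    rcases hstep with h | h | h
    · refine Or.inl (Prod.ext (eq_add_two_of_val ?_) ?_)
      · simp only [staircase]
        omega
      · simp only [staircase, h, Prod.snd_add, add_zero]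
    · refine Or.inr (Or.inl (Prod.ext (eq_add_one_of_val ?_) (eq_add_one_of_val h)))
      simp only [staircase]
      omega
    · refine Or.inr (Or.inr (Prod.ext ?_ (eq_add_two_of_val h)))
      simp only [staircase, Prod.fst_add, add_zero, Fin.mk.injEq]
      omega
  · have hval : (i + 1).val = 0 := by rw [val_add_one_eq_ite, if_neg hi]
    refine Or.inr (Or.inl (Prod.ext ?_ ?_)) <;>
      simp only [staircase, Prod.fst_add, Prod.snd_add, Fin.ext_iff, val_add_one_eq_ite, hval,
        stairHeight] <;> split_ifs <;> omega

end Staircase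

section Parity

variable {q : ℕ}

theorem even_val_sub_iff (x y : Fin (2 * q)) :
    Even (x - y).val ↔ (Even x.val ↔ Even y.val) := by
  rw [val_sub_eq_ite]
  simp only [Nat.even_iff]
  split_ifs <;> omega

theorem odd_val_sub_iff (x y : Fin (2 * q)) :
    Odd (x - y).val ↔ (Odd x.val ↔ Even y.val) := by
  simp only [← Nat.not_even_iff_odd, even_val_sub_iff, not_iff]

theorem even_val_add_one_iff [NeZero q] (x : Fin (2 * q)) : Even (x + 1).val ↔ Odd x.val := by
  rw [val_add_one_eq_ite]
  simp only [Nat.even_iff, Nat.odd_iff]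
  split_ifs <;> omega

/-- The `k`-th even point of the cyclic order `Fin (2 * q)`. -/
def evenPoint (k : Fin q) : Fin (2 * q) := ⟨2 * k, by omega⟩

/-- The `k`-th odd point of the cyclic order `Fin (2 * q)`. -/
def oddPoint (k : Fin q) : Fin (2 * q) := ⟨2 * k + 1, by omega⟩

theorem range_evenPoint : Set.range (evenPoint (q := q)) = {x | Even x.val} := by
  ext x
  refine ⟨fun ⟨k, hk⟩ => hk ▸ even_two_mul k.val, fun ⟨k, hk⟩ => ⟨⟨k, by omega⟩, Fin.ext ?_⟩⟩
  simp only [evenPoint]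
  omega

theorem range_oddPoint : Set.range (oddPoint (q := q)) = {x | Odd x.val} := by
  ext x
  refine ⟨fun ⟨k, hk⟩ => hk ▸ odd_two_mul_add_one k.val,
    fun ⟨k, hk⟩ => ⟨⟨k, by omega⟩, Fin.ext hk.symm⟩⟩

theorem ncard_even : {x : Fin (2 * q) | Even x.val}.ncard = q := by
  rw [← range_evenPoint, Set.ncard_range_of_injective, Nat.card_fin]
  intro k l h
  simpa [evenPoint, Fin.ext_iff] using h

theorem ncard_odd : {x : Fin (2 * q) | Odd x.val}.ncard = q := by
  rw [← range_oddPoint, Set.ncard_range_of_injective, Nat.card_fin]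
  intro k l h
  simpa [oddPoint, Fin.ext_iff] using h

variable (q) in
/-- The pair of combinatorial multicones of rank `q` on the cyclic order `Fin (2 * q)` whose
unstable points are the even ones. -/
def parityPair : MulticonePair (Fin (2 * q)) where
  stable := {x | Odd x.val}
  unstable := {x | Even x.val}
  isCompl := eq_compl_iff_isCompl.1 (Set.ext fun _ => Nat.not_even_iff_odd.symm)
  ncard_eq := ncard_odd.trans ncard_even.symm
  alternate x y h := by
    have : NeZero q := ⟨by have := x.isLt; omega⟩
    obtain rfl := (isNext_iff_eq_add_one (by have := x.isLt; omega)).1 h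
    exact (even_val_add_one_iff x).symm

theorem rank_parityPair : (parityPair q).rank = q :=
  ncard_even

end Parity

section Translate

variable {n : ℕ} [NeZero n] {s s' u u' x y : Fin n}

theorem val_sub_add_one_eq_pred_iff : (x - (y + 1)).val = n - 1 ↔ x = y := by
  simp only [val_sub_eq_ite, Fin.le_def, val_add_one_eq_ite, Fin.ext_iff]
  grind

theorem eq_arcMap_iff_of_ne_right (hx : x ≠ s') :
    y = arcMap s s' u u' x ↔
      (y - u).val = if (s - (s' + 1)).val < (x - (s' + 1)).val then (u' - u).val else 0 := by
  simp only [arcMap, sbtw_iff_sub_add_one_lt_sub, ne_eq, hx, not_false_eq_true, true_and,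
    Fin.lt_def]
  split_ifs
  · rw [Fin.val_inj, sub_left_inj]
  · rw [Fin.val_eq_zero_iff, sub_eq_zero]

theorem eq_arcMap_iff_of_ne_left (hy : y ≠ u) :
    x = arcMap u u' s' s y ↔
      (x - (s' + 1)).val = if (y - u).val < (u' - u).val then (s - (s' + 1)).val else n - 1 := by
  simp only [arcMap, sbtw_iff_sub_lt_sub, ne_eq, hy, not_false_eq_true, true_and, Fin.lt_def]
  split_ifs
  · rw [Fin.val_inj, sub_left_inj]
  · rw [val_sub_add_one_eq_pred_iff]

end Translate

namespace parityPair

variable {q : ℕ} [NeZero q] {s s' u u' : Fin (2 * q)}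

theorem mem_graph_arcMap_iff (hs : s ∈ (parityPair q).stable) (hs' : s' ∈ (parityPair q).stable)
    (hu : u ∈ (parityPair q).unstable) (hu' : u' ∈ (parityPair q).unstable)
    (p : Fin (2 * q) × Fin (2 * q)) :
    p ∈ (parityPair q).graph (arcMap u u' s' s) (arcMap s s' u u') ↔
      p - (s' + 1, u) ∈ Set.range (staircase (s - (s' + 1)) (u' - u)) := by
  have hs'' : Even (s' + 1).val := (even_val_add_one_iff s').2 hs'
  have hX : Even p.1.val ↔ Even (p.1 - (s' + 1)).val :=
    (iff_true_right hs'').symm.trans (even_val_sub_iff _ _).symm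
  have hY : Odd p.2.val ↔ Odd (p.2 - u).val :=
    (iff_true_right hu).symm.trans (odd_val_sub_iff _ _).symm
  have hσ : Odd (s - (s' + 1)).val := (odd_val_sub_iff _ _).2 (iff_of_true hs hs'')
  have hβ : Even (u' - u).val := (even_val_sub_iff _ _).2 (iff_of_true hu' hu)
  rw [mem_range_staircase_iff (even_two_mul q) hσ hβ, MulticonePair.mem_graph]
  refine or_congr ?_ ?_
  · refine (and_congr_right fun hx => eq_arcMap_iff_of_ne_right ?_).trans (and_congr_left' hX)
    exact fun h => MulticonePair.notMem_stable hx (h ▸ hs')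
  · refine (and_congr_left fun hy => eq_arcMap_iff_of_ne_left ?_).trans (and_congr_right' hY)
    exact fun h => MulticonePair.notMem_stable hu (h ▸ hy)

theorem isMonotonic_graph_arcMap (hs : s ∈ (parityPair q).stable)
    (hs' : s' ∈ (parityPair q).stable) (hu : u ∈ (parityPair q).unstable)
    (hu' : u' ∈ (parityPair q).unstable) :
    (parityPair q).IsMonotonic ((parityPair q).graph (arcMap u u' s' s) (arcMap s s' u u')) := by
  have hn : 1 < 2 * q := by have := NeZero.pos q; omega
  refine MulticonePair.isMonotonic_graph (fun x _ => arcMap_mem hs' hs u u' x)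
    (fun x _ => arcMap_mem hu hu' s s' x) hn
    (fun i => (s' + 1, u) + staircase (s - (s' + 1)) (u' - u) i)
    ((add_right_injective _).comp (staircase_injective _ _)) (fun p => ?_) (fun i => ?_)
  · simp only [mem_graph_arcMap_iff hs hs' hu hu', Set.mem_range, eq_sub_iff_add_eq']
  · refine isStep_of_eq_add hn ?_
    simpa only [add_assoc, add_right_inj] using staircase_add_one _ _ i

theorem isMonotonic_const (hs : s ∈ (parityPair q).stable) (hu : u ∈ (parityPair q).unstable) :
    (parityPair q).IsMonotonic ((parityPair q).const s u) := by
  have h := isMonotonic_graph_arcMap hs hs hu hu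
  rwa [MulticonePair.graph_congr (fun x _ => arcMap_self u s s x)
    fun x _ => arcMap_self s u u x] at h

theorem isMonotonic_one : (parityPair q).IsMonotonic 1 := by
  have hn : 1 < 2 * q := by have := NeZero.pos q; omega
  rw [← MulticonePair.graph_id]
  refine MulticonePair.isMonotonic_graph (Set.mapsTo_id _) (Set.mapsTo_id _) hn
    (fun i => (i, i)) (fun i j h => congrArg Prod.fst h) (fun p => ?_) (fun i => ?_)
  · rw [MulticonePair.graph_id, Correspondence.mem_one]
    exact ⟨fun h => ⟨p.1, Prod.ext rfl h⟩, fun ⟨i, hi⟩ => hi ▸ rfl⟩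
  · exact isStep_of_eq_add hn (Or.inr (Or.inl rfl))

end parityPair

/-! ### Two linked generators -/

section CastLE

variable {m n : ℕ} (h : m ≤ n)

theorem sbtw_castLE_iff (a x b : Fin m) :
    sbtw (Fin.castLE h a) (Fin.castLE h x) (Fin.castLE h b) ↔
      a < x ∧ x < b ∨ x < b ∧ b < a ∨ b < a ∧ a < x := by
  simp only [Fin.sbtw_iff, Fin.castLE_lt_castLE_iff]

theorem arcMap_castLE (a b v v' x : Fin m) :
    arcMap (Fin.castLE h a) (Fin.castLE h b) (Fin.castLE h v) (Fin.castLE h v') (Fin.castLE h x) =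
      Fin.castLE h (if a < x ∧ x < b ∨ x < b ∧ b < a ∨ b < a ∧ a < x then v' else v) := by
  simp only [arcMap, sbtw_castLE_iff, apply_ite (Fin.castLE h)]

end CastLE

section Linked

variable {q : ℕ} (h : 20 ≤ 2 * q)

/-- The stable points which begin the arcs of the two linked generators. The unstable map of the
`i`-th one has value `unstableRight h i` on the arc from `stableLeft h i` to `stableRight h i` and
`unstableLeft h i` elsewhere; its stable map has value `stableLeft h i` on the arc from
`unstableLeft h i` to `unstableRight h i` and `stableRight h i` elsewhere. -/
def stableLeft (i : Fin 2) : Fin (2 * q) := Fin.castLE h (![1, 5] i)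

/-- The stable points which end the arcs of the two linked generators, see `stableLeft`. -/
def stableRight (i : Fin 2) : Fin (2 * q) := Fin.castLE h (![9, 13] i)

/-- The unstable points which begin the arcs of the two linked generators, see `stableLeft`. -/
def unstableLeft (i : Fin 2) : Fin (2 * q) := Fin.castLE h (![14, 16] i)

/-- The unstable points which end the arcs of the two linked generators, see `stableLeft`. -/
def unstableRight (i : Fin 2) : Fin (2 * q) := Fin.castLE h (![18, 0] i)

/-- The stable maps of all the generators: the two linked ones and one constant generator for each
value. -/
noncomputable def linkedStable : Fin (2 + q) → Fin (2 * q) → Fin (2 * q) :=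
  Fin.append (fun i => arcMap (unstableLeft h i) (unstableRight h i) (stableRight h i)
    (stableLeft h i)) fun k _ => oddPoint k

/-- The unstable maps of all the generators, see `linkedStable`. -/
noncomputable def linkedUnstable : Fin (2 + q) → Fin (2 * q) → Fin (2 * q) :=
  Fin.append (fun i => arcMap (stableLeft h i) (stableRight h i) (unstableLeft h i)
    (unstableRight h i)) fun k _ => evenPoint k

theorem stableLeft_mem (i : Fin 2) : stableLeft h i ∈ (parityPair q).stable :=
  (by decide : ∀ i, Odd (![1, 5] i : Fin 20).val) i

theorem stableRight_mem (i : Fin 2) : stableRight h i ∈ (parityPair q).stable :=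
  (by decide : ∀ i, Odd (![9, 13] i : Fin 20).val) i

theorem unstableLeft_mem (i : Fin 2) : unstableLeft h i ∈ (parityPair q).unstable :=
  (by decide : ∀ i, Even (![14, 16] i : Fin 20).val) i

theorem unstableRight_mem (i : Fin 2) : unstableRight h i ∈ (parityPair q).unstable :=
  (by decide : ∀ i, Even (![18, 0] i : Fin 20).val) i

theorem contractsInTwoSteps_linkedStable :
    ContractsInTwoSteps (parityPair q).stable (linkedStable h) := by
  refine (contractsInTwoSteps_arcMap (stableRight_mem h) (stableLeft_mem h) ?_ ?_).append_const
    fun k => range_oddPoint.le ⟨k, rfl⟩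
  all_goals
    simp only [stableLeft, stableRight, unstableLeft, unstableRight, sbtw_castLE_iff]
    decide

theorem contractsInTwoSteps_linkedUnstable :
    ContractsInTwoSteps (parityPair q).unstable (linkedUnstable h) := by
  refine (contractsInTwoSteps_arcMap (unstableLeft_mem h) (unstableRight_mem h) ?_ ?_).append_const
    fun k => range_evenPoint.le ⟨k, rfl⟩
  all_goals
    simp only [stableLeft, stableRight, unstableLeft, unstableRight, sbtw_castLE_iff]
    decide

theorem isMonotonic_graph_linked (i : Fin (2 + q)) :
    (parityPair q).IsMonotonic ((parityPair q).graph (linkedStable h i) (linkedUnstable h i)) := by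
  have : NeZero q := ⟨by omega⟩
  unfold linkedStable linkedUnstable
  refine Fin.addCases (fun i => ?_) (fun k => ?_) i
  · rw [Fin.append_left, Fin.append_left]
    exact parityPair.isMonotonic_graph_arcMap (stableLeft_mem h i) (stableRight_mem h i)
      (unstableLeft_mem h i) (unstableRight_mem h i)
  · rw [Fin.append_right, Fin.append_right]
    exact parityPair.isMonotonic_const (range_oddPoint.le ⟨k, rfl⟩) (range_evenPoint.le ⟨k, rfl⟩)

theorem linkedUnstable_castAdd_castLE (k : Fin 8) :
    linkedUnstable h (Fin.castAdd q (![0, 0, 1, 1, 0, 0, 1, 1] k))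
        (Fin.castLE h (![0, 2, 4, 6, 8, 10, 12, 14] k)) =
      Fin.castLE h (![14, 16, 18, 0] (![0, 2, 1, 3, 2, 0, 3, 1] k : Fin 4)) := by
  simp only [linkedUnstable, Fin.append_left, stableLeft, stableRight, unstableLeft, unstableRight,
    arcMap_castLE]
  refine congrArg _ ?_
  revert k
  decide

theorem not_isInducedBy_linked (A : Fin (2 + q) → Matrix.SpecialLinearGroup (Fin 2) ℝ) :
    ¬ (parityPair q).IsInducedBy
      ((parityPair q).graphMorphism (linkedStable h) (linkedUnstable h)) A := by
  refine MulticonePair.not_isInducedBy (Fin.castAdd q)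
    (fun k => Fin.castLE h (![0, 2, 4, 6, 8, 10, 12, 14] k)) ?_
    (fun k => Fin.castLE h (![14, 16, 18, 0] k)) ?_ fun k => ?_
  · simp only [sbtw_castLE_iff]
    decide
  · simp only [sbtw_castLE_iff]
    decide
  · rw [MulticonePair.graphMorphism_of, MulticonePair.mem_graph, linkedUnstable_castAdd_castLE]
    exact Or.inl ⟨(by decide : ∀ k, Even (![0, 2, 4, 6, 8, 10, 12, 14] k : Fin 20).val) k, rfl⟩

end Linked

theorem proposition5p7_general (q : ℕ) (hq : 10 ≤ q) :
    ∃ (N : ℕ) (M : Type) (_ : Finite M) (_ : CircularOrder M) (P : MulticonePair M)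
      (Φ : FreeMonoid (Fin N) →* Correspondence M),
      2 ≤ N ∧ P.rank = q ∧ (∀ w, Φ w ∈ P.monotonic) ∧ P.IsTight Φ ∧ P.IsHyperbolic Φ ∧
      ∀ A : Fin N → Matrix.SpecialLinearGroup (Fin 2) ℝ, ¬ P.IsInducedBy Φ A := by
  have : NeZero q := ⟨by omega⟩
  have h : 20 ≤ 2 * q := by omega
  have hs := contractsInTwoSteps_linkedStable h
  have hu := contractsInTwoSteps_linkedUnstable h
  refine ⟨2 + q, Fin (2 * q), inferInstance, inferInstance, parityPair q,
    (parityPair q).graphMorphism (linkedStable h) (linkedUnstable h), Nat.le_add_right 2 q,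
    rank_parityPair, ?_, ?_, ?_, not_isInducedBy_linked h⟩
  · exact MulticonePair.graphMorphism_mem_monotonic hs hu parityPair.isMonotonic_one
      (isMonotonic_graph_linked h) fun _ has _ hau => parityPair.isMonotonic_const has hau
  · exact MulticonePair.isTight_append_const range_oddPoint range_evenPoint
  · exact MulticonePair.isHyperbolic_graphMorphism hs hu

end MulticoneDynamics

open MulticoneDynamics in
theorem proposition5p7 :
    ∃ (N : ℕ) (M : Type) (_ : Finite M) (_ : CircularOrder M) (P : MulticonePair M)
      (Φ : FreeMonoid (Fin N) →* Correspondence M),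
      2 ≤ N ∧ P.rank = 15 ∧ (∀ w, Φ w ∈ P.monotonic) ∧ P.IsTight Φ ∧ P.IsHyperbolic Φ ∧
      ∀ A : Fin N → Matrix.SpecialLinearGroup (Fin 2) ℝ,
        IsUniformlyHyperbolic A → ¬ P.IsInducedBy Φ A := by
  obtain ⟨N, M, hM, hM', P, Φ, hN, hP, hmono, htight, hhyp, hind⟩ :=
    proposition5p7_general 15 (by norm_num)
  exact ⟨N, M, hM, hM', P, Φ, hN, hP, hmono, htight, hhyp, fun A _ => hind A⟩
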